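/- Let $\varphi:\mathbb{R}^2\to[0,\infty)$ be a (jointly measurable) stationary and ergodic random field with law $\overline{\mathbb P}$. Here stationary means that its finite-dimensional distributions are invariant under all translations of $\mathbb{R}^2$, and ergodic means that every event of the $\sigma$-algebra generated by the evaluation maps $\varphi\mapsto\varphi(x)$ which is invariant, up to null sets, under each translation has $\overline{\mathbb P}$-probability $0$ or $1$. For $\lambda>0$ let $\eta$ be a homogeneous Poisson point process of intensity $\lambda$ on $\mathbb{R}^2\times[0,1]$ with law $\mathbb{P}_\lambda$, identified with its set of points, let $\mathbf{P}_\lambda=\mathbb{P}_\lambda\times\overline{\mathbb P}$ (so that $\eta$ and $\varphi$ are independent), and let $$\mathcal{O}=\mathcal{O}(\eta,\varphi)=\bigcup_{(x,z)\in\eta}B\big(x,\varphi(x)\big),$$ where $B(x,r)$ is the closed Euclidean disc with centre $x$ and radius $r$. Then the following statements are equivalent: a) $\mathbf{P}_\lambda(0\in\mathcal{O})=1$ for some $\lambda>0$; b) $\mathbf{P}_\lambda(0\in\mathcal{O})=1$ for every $\lambda>0$; c) $\mathbf{P}_\lambda(\mathcal{O}=\mathbb{R}^2)=1$ for every $\lambda>0$.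 -/

import Mathlib

open MeasureTheory ProbabilityTheory Set
open scoped NNReal ENNReal

namespace Gilbert

/-- The Euclidean plane `ℝ²`. -/
abbrev Plane : Type := EuclideanSpace ℝ (Fin 2)

/-- The space `ℝ² × [0,1]` on which the Poisson process lives. -/
abbrev MarkedPlane : Type := Plane × unitInterval

/-- The counting measures on `ℝ² × [0,1]`: Borel measures whose value on every bounded Borel set is
a (finite) nonnegative integer. -/
def Config : Type :=
  {ν : Measure MarkedPlane //
    ∀ B : Set MarkedPlane, MeasurableSet B → Bornology.IsBounded B → ∃ n : ℕ, ν B = n}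

/-- The number `ν(B)` of points of the configuration `ν` in `B`. -/
def Config.count (ν : Config) (B : Set MarkedPlane) : ℝ≥0∞ := ν.1 B

/-- The smallest sigma algebra on the space of counting measures that makes `ν ↦ ν(B)` measurable
for every Borel set `B ⊆ ℝ² × [0,1]`. -/
instance : MeasurableSpace Config :=
  ⨆ (B : Set MarkedPlane) (_ : MeasurableSet B),
    MeasurableSpace.comap (fun ν : Config => ν.count B) inferInstance

lemma Config.measurable_count {B : Set MarkedPlane} (hB : MeasurableSet B) :
    Measurable (fun ν : Config => ν.count B) :=
  Measurable.of_comap_le (le_iSup₂_of_le B hB le_rfl)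

/-- The support of a counting measure, i.e. the set of its points. -/
def Config.points (ν : Config) : Set MarkedPlane := ν.1.support

/-- `P` is the law of a homogeneous Poisson point process on `ℝ² × [0,1]` with intensity `l`: the
number of points in a Borel set `B` of finite volume is Poisson distributed with mean `l * vol(B)`,
and the numbers of points in pairwise disjoint Borel sets are independent. -/
structure IsPoissonLaw (l : ℝ≥0) (P : Measure Config) : Prop where
  isProbabilityMeasure : IsProbabilityMeasure P
  map_count : ∀ B : Set MarkedPlane, MeasurableSet B → volume B ≠ ∞ →
    P.map (fun ν => ν.count B) =
      (poissonMeasure (l * (volume B).toNNReal)).map (fun n : ℕ => (n : ℝ≥0∞))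
  indep_count : ∀ (n : ℕ) (B : Fin n → Set MarkedPlane), (∀ i, MeasurableSet (B i)) →
    Pairwise (fun i j => Disjoint (B i) (B j)) →
    iIndepFun (fun i (ν : Config) => ν.count (B i)) P

section Field

variable {Θ : Type*} [MeasurableSpace Θ]

/-- Stationarity of the random field `φ : ℝ² → [0,∞)`, defined on the probability space `(Θ, Q)`:
the finite-dimensional distributions are invariant under translations. -/
def IsStationary (φ : Θ → Plane → ℝ≥0) (Q : Measure Θ) : Prop :=
  ∀ (x : Plane) (k : ℕ) (y : Fin k → Plane),
    IdentDistrib (fun θ i => φ θ (y i + x)) (fun θ i => φ θ (y i)) Q Q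

/-- The shift `f ↦ f(· - x)` on the space of nonnegative functions on the plane. -/
def shift (x : Plane) (f : Plane → ℝ≥0) : Plane → ℝ≥0 := fun y => f (y - x)

/-- Ergodicity of the random field `φ`: under the law of `φ` on the space of nonnegative functions
with the sigma algebra generated by the evaluation maps, every translation invariant event has
probability zero or one. As in Mathlib's `ErgodicSMul`, invariance of an event means invariance up
to null sets, for each translation. -/
def IsErgodic (φ : Θ → Plane → ℝ≥0) (Q : Measure Θ) : Prop :=
  ∀ A : Set (Plane → ℝ≥0), MeasurableSet A →
    (∀ x : Plane, shift x ⁻¹' A =ᵐ[Q.map φ] A) →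
    Q.map φ A = 0 ∨ Q.map φ A = 1

end Field

/-- The occupied set `𝒪(η, f)`: the union of the closed Euclidean discs `B(x, f(x))` over the points
`(x, z)` of `η`. -/
def occupied (η : Config) (f : Plane → ℝ≥0) : Set Plane :=
  ⋃ p ∈ η.points, Metric.closedBall p.1 (f p.1 : ℝ)

end Gilbert

/-! Given the field, the origin is vacant exactly when the Poisson process misses `coveringSet f 0
×ˢ univ`, which has probability exp(-λ vol). So a) says, for any λ > 0, that this set almost surely
has infinite volume. To pass from a point to the plane, split the set into four cones. One of them
has infinite volume with some probability p > 0. Moving the origin 4n along its axis brings distant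
centres closer by n, so by stationarity `coveringSet f n` has infinite volume with probability at
least p, for each n. These events decrease in n and their intersection is translation invariant, so
ergodicity makes it almost sure. The Poisson process then hits every `coveringSet f n`, which covers
the plane. Volume is not a priori measurable for the σ-algebra of evaluations; infinite volume is
therefore tested along a fixed sequence of points, chosen by Borel–Cantelli and Fubini. -/

namespace Gilbert

open Filter Topology
open scoped Pointwise

/-! ### Testing infinite volume by sampling -/

/-- Lebesgue measure on the plane is, as far as infinite volume is concerned, the sum of a sequence
of probability measures. -/
lemma exists_seq_isProbabilityMeasure_tsum_eq_top_iff :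
    ∃ ν : ℕ → Measure Plane, (∀ n, IsProbabilityMeasure (ν n)) ∧
      ∀ S : Set Plane, ∑' n, ν n S = ∞ ↔ volume S = ∞ := by
  let b := (EuclideanSpace.basisFun (Fin 2) ℝ).toBasis
  let D := ZSpan.fundamentalDomain b
  let G := Submodule.span ℤ (Set.range b)
  have hD : IsAddFundamentalDomain G D (volume : Measure Plane) :=
    ZSpan.isAddFundamentalDomain b volume
  have hcount : Countable G := inferInstance
  have hinv : VAddInvariantMeasure G Plane volume :=
    inferInstanceAs <| VAddInvariantMeasure G.toAddSubgroup Plane volume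
  have hD0 : volume D ≠ 0 := ZSpan.measure_fundamentalDomain_ne_zero b
  have hDtop : volume D ≠ ∞ := (ZSpan.fundamentalDomain_isBounded b).measure_lt_top.ne
  have hcell (g : G) : volume (g +ᵥ D) = volume D := measure_vadd volume g D
  have hinf : Infinite G := by
    by_contra h
    have : Finite G := not_infinite_iff_finite.1 h
    have := Fintype.ofFinite G
    have h1 := hD.measure_eq_tsum' univ
    simp only [univ_inter, hcell, tsum_fintype, Finset.sum_const, nsmul_eq_mul] at h1
    rw [measure_univ_of_isAddLeftInvariant] at h1
    exact ENNReal.mul_ne_top (ENNReal.natCast_ne_top _) hDtop h1.symm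
  obtain ⟨e⟩ : Nonempty (ℕ ≃ G) := nonempty_equiv_of_countable
  -- Uniform laws on the cells of a lattice; all cells have the same volume.
  refine ⟨fun n => (volume D)⁻¹ • volume.restrict (e n +ᵥ D), fun n => ⟨?_⟩, fun S => ?_⟩
  · simp [hcell, ENNReal.inv_mul_cancel hD0 hDtop]
  · have hmeas (g : G) : MeasurableSet (g +ᵥ D) :=
      (ZSpan.fundamentalDomain_measurableSet b).const_vadd g
    have : ∑' n, ((volume D)⁻¹ • volume.restrict (e n +ᵥ D)) S = (volume D)⁻¹ * volume S := by
      simp only [Measure.smul_apply, smul_eq_mul, Measure.restrict_apply' (hmeas _)]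
      rw [ENNReal.tsum_mul_left, hD.measure_eq_tsum' S,
        e.tsum_eq (fun g : G => volume (S ∩ (g +ᵥ D)))]
    rw [this, ENNReal.mul_eq_top]
    simp [hD0, hDtop]

/-- Both halves of the Borel–Cantelli lemma for independent random points. -/
lemma ae_frequently_mem_iff_tsum_eq_top {E : Type*} [MeasurableSpace E] (ν : ℕ → Measure E)
    [∀ n, IsProbabilityMeasure (ν n)] {S : Set E} (hS : MeasurableSet S) :
    ∀ᵐ y ∂Measure.infinitePi ν, (∃ᶠ n in atTop, y n ∈ S) ↔ ∑' n, ν n S = ∞ := by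
  let s : ℕ → Set (ℕ → E) := fun n => {y | y n ∈ S}
  have hs (n : ℕ) : MeasurableSet (s n) := measurable_pi_apply n hS
  have hval (n : ℕ) : Measure.infinitePi ν (s n) = ν n S :=
    (measurePreserving_eval_infinitePi ν n).measure_preimage hS.nullMeasurableSet
  have hlim (y : ℕ → E) : y ∈ limsup s atTop ↔ ∃ᶠ n in atTop, y n ∈ S := mem_limsup_iff_frequently_mem
  by_cases h : ∑' n, ν n S = ∞
  · have hind : iIndepSet s (Measure.infinitePi ν) := by
      have := iIndepFun_infinitePi (P := ν) (X := fun _ : ℕ => (id : E → E)) (fun _ => measurable_id)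
      exact (iIndepSet_iff_meas_biInter hs).2 fun t => this.meas_biInter fun n _ => ⟨S, hS, rfl⟩
    have h1 := measure_limsup_eq_one hs hind (by simpa only [hval] using h)
    have h2 : ∀ᵐ y ∂Measure.infinitePi ν, y ∈ limsup s atTop :=
      (prob_compl_eq_zero_iff (MeasurableSet.measurableSet_limsup hs)).2 h1
    filter_upwards [h2] with y hy
    simpa [h] using (hlim y).1 hy
  · have h1 := measure_limsup_atTop_eq_zero (μ := Measure.infinitePi ν) (s := s)
      (by simpa only [hval] using h)
    have h2 : ∀ᵐ y ∂Measure.infinitePi ν, y ∉ limsup s atTop := measure_eq_zero_iff_ae_notMem.1 h1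
    filter_upwards [h2] with y hy
    simpa [h] using mt (hlim y).2 hy

/-- A random set has infinite volume if and only if it contains infinitely many points of a suitable
deterministic sequence. -/
lemma ae_ae_frequently_mem_iff {Θ : Type*} [MeasurableSpace Θ] (Q : Measure Θ) [SFinite Q]
    {ν : ℕ → Measure Plane} [∀ n, IsProbabilityMeasure (ν n)]
    (hν : ∀ S : Set Plane, ∑' n, ν n S = ∞ ↔ volume S = ∞)
    {S : Set (Θ × Plane)} (hS : MeasurableSet S) :
    ∀ᵐ y ∂Measure.infinitePi ν, ∀ᵐ θ ∂Q,
      (∃ᶠ n in atTop, (θ, y n) ∈ S) ↔ volume {x | (θ, x) ∈ S} = ∞ := by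
  rw [← Measure.ae_ae_comm (p := fun θ (y : ℕ → Plane) =>
    (∃ᶠ n in atTop, (θ, y n) ∈ S) ↔ volume {x | (θ, x) ∈ S} = ∞)]
  · refine ae_of_all _ fun θ => ?_
    filter_upwards [ae_frequently_mem_iff_tsum_eq_top ν
      (S := {x | (θ, x) ∈ S}) (measurable_prodMk_left hS)] with y hy
    exact hy.trans (hν _)
  · have h1 : MeasurableSet {q : Θ × (ℕ → Plane) | ∃ᶠ n in atTop, (q.1, q.2 n) ∈ S} := by
      have (n : ℕ) : MeasurableSet {q : Θ × (ℕ → Plane) | (q.1, q.2 n) ∈ S} :=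
        (by fun_prop : Measurable fun q : Θ × (ℕ → Plane) => (q.1, q.2 n)) hS
      convert MeasurableSet.measurableSet_limsup this using 1
      ext q
      rw [mem_limsup_iff_frequently_mem]
      rfl
    have h2 : MeasurableSet {q : Θ × (ℕ → Plane) | volume {x | (q.1, x) ∈ S} = ∞} :=
      ((measurable_measure_prodMk_left hS).comp measurable_fst) (measurableSet_singleton ∞)
    exact h1.iff h2

/-! ### Geometry of covering sets -/

/-- The points `y` whose disc `B(y, f(y))` contains the disc of radius `t` about the origin. -/
def coveringSet (f : Plane → ℝ≥0) (t : ℝ) : Set Plane := {y | ‖y‖ + t ≤ f y}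

lemma measurableSet_coveringSet {f : Plane → ℝ≥0} (hf : Measurable f) (t : ℝ) :
    MeasurableSet (coveringSet f t) :=
  measurableSet_le (by fun_prop) (by fun_prop)

lemma volume_coveringSet_shift (f : Plane → ℝ≥0) (x : Plane) (t : ℝ) :
    volume (coveringSet (shift x f) t) = volume {y | ‖y + x‖ + t ≤ f y} := by
  rw [← measure_preimage_add_right volume x]
  congr 1
  ext y
  simp [coveringSet, shift]

lemma volume_coveringSet_shift_eq_top {f : Plane → ℝ≥0} (x : Plane)
    (h : ∀ n : ℕ, volume (coveringSet f n) = ∞) (n : ℕ) :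
    volume (coveringSet (shift x f) n) = ∞ := by
  obtain ⟨m, hm⟩ := exists_nat_ge (‖x‖ + n)
  rw [volume_coveringSet_shift]
  refine measure_mono_top (fun y (hy : ‖y‖ + m ≤ f y) => ?_) (h m)
  have := norm_add_le y x
  simp only [mem_ofPred_eq]
  linarith

lemma forall_volume_coveringSet_shift_iff (f : Plane → ℝ≥0) (x : Plane) :
    (∀ n : ℕ, volume (coveringSet (shift x f) n) = ∞) ↔ ∀ n : ℕ, volume (coveringSet f n) = ∞ := by
  refine ⟨fun h => ?_, volume_coveringSet_shift_eq_top x⟩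
  have hf : shift (-x) (shift x f) = f := by
    ext y
    simp [shift]
  rw [← hf]
  exact volume_coveringSet_shift_eq_top (-x) h

/-- The four unit vectors parallel to the coordinate axes. -/
noncomputable def axisDirection (k : Fin 2 × Bool) : Plane := EuclideanSpace.single k.1 (if k.2 then 1 else -1)

/-- The closed cone of vectors at angle at most `π / 3` with `e`. -/
def cone (e : Plane) : Set Plane := {y | ‖y‖ / 2 ≤ inner ℝ y e}

lemma measurableSet_cone (e : Plane) : MeasurableSet (cone e) :=
  measurableSet_le (by fun_prop) (by fun_prop)

lemma norm_axisDirection (k : Fin 2 × Bool) : ‖axisDirection k‖ = 1 := by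
  rw [axisDirection, PiLp.norm_single]
  split_ifs <;> simp

/-- Outside all four cones both coordinates would be below ‖y‖/2 in absolute value, too small for
the norm. -/
lemma exists_mem_cone_axisDirection (y : Plane) : ∃ k, y ∈ cone (axisDirection k) := by
  by_contra! h
  have h1 := h (0, true)
  have h2 := h (0, false)
  have h3 := h (1, true)
  have h4 := h (1, false)
  simp only [cone, axisDirection, mem_ofPred_eq, not_le,
    EuclideanSpace.inner_single_right] at h1 h2 h3 h4
  simp only [if_true, Bool.false_eq_true, if_false, one_mul, neg_mul, conj_trivial] at h1 h2 h3 h4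
  have hn : ‖y‖ ^ 2 = y 0 ^ 2 + y 1 ^ 2 := by
    rw [EuclideanSpace.norm_sq_eq]
    simp
  have h0 := norm_nonneg y
  have e0 : y 0 ^ 2 ≤ (‖y‖ / 2) ^ 2 := sq_le_sq' (by linarith) (by linarith)
  have e1 : y 1 ^ 2 ≤ (‖y‖ / 2) ^ 2 := sq_le_sq' (by linarith) (by linarith)
  have : ‖y‖ = 0 := by nlinarith
  linarith

/-- Moving towards a far away point of a cone along its axis reduces the distance by a fixed
proportion of the step. -/
lemma norm_sub_smul_le_of_mem_cone {e y : Plane} (he : ‖e‖ = 1) (hy : y ∈ cone e) {s : ℝ}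
    (hs : 0 ≤ s) (hys : 2 * s ≤ ‖y‖) : ‖y - s • e‖ + s / 4 ≤ ‖y‖ := by
  have h1 : ‖y - s • e‖ ^ 2 = ‖y‖ ^ 2 - 2 * (s * inner ℝ y e) + s ^ 2 := by
    rw [norm_sub_sq_real, inner_smul_right, norm_smul, he]
    simp
  have hy' : ‖y‖ / 2 ≤ inner ℝ y e := hy
  -- Reduces to s‖y‖/2 ≥ 15s²/16, which follows from ‖y‖ ≥ 2s.
  have h2 : ‖y - s • e‖ ^ 2 ≤ (‖y‖ - s / 4) ^ 2 := by nlinarith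
  have := abs_le_of_sq_le_sq h2 (by linarith)
  linarith [le_abs_self ‖y - s • e‖]

lemma volume_coveringSet_shift_of_cone {f : Plane → ℝ≥0} {e : Plane} (he : ‖e‖ = 1)
    (h : volume (cone e ∩ coveringSet f 0) = ∞) (n : ℕ) :
    volume (coveringSet (shift (-((4 * n : ℝ) • e)) f) n) = ∞ := by
  rw [volume_coveringSet_shift]
  -- The gain is a quarter of the step, so gaining n takes s = 4n, valid for ‖y‖ ≥ 2s = 8n; the
  -- discarded ball has finite volume.
  have hb : volume ((cone e ∩ coveringSet f 0) \ Metric.ball 0 (8 * n)) = ∞ := by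
    by_contra hne
    have h1 := measure_union_lt_top (lt_top_iff_ne_top.2 hne)
      (measure_ball_lt_top (μ := volume) (x := (0 : Plane)) (r := 8 * n))
    rw [sdiff_union_self] at h1
    exact (measure_mono_top subset_union_left h).not_lt h1
  refine measure_mono_top (fun y hy => ?_) hb
  obtain ⟨⟨hc, hy0⟩, hyb⟩ := hy
  have hy0 : ‖y‖ + 0 ≤ f y := hy0
  have hyb : 8 * (n : ℝ) ≤ ‖y‖ := by simpa using hyb
  have := norm_sub_smul_le_of_mem_cone he hc (s := 4 * n) (by positivity) (by linarith)
  simp only [mem_ofPred_eq, ← sub_eq_add_neg]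
  linarith

lemma exists_volume_cone_inter_eq_top {S : Set Plane} (h : volume S = ∞) :
    ∃ k, volume (cone (axisDirection k) ∩ S) = ∞ := by
  by_contra! hk
  have : S ⊆ ⋃ k, cone (axisDirection k) ∩ S := fun y hy => by
    obtain ⟨k, hk⟩ := exists_mem_cone_axisDirection y
    exact mem_iUnion.2 ⟨k, hk, hy⟩
  have h1 := (measure_mono this).trans (measure_iUnion_fintype_le volume _)
  rw [h, top_le_iff, ENNReal.sum_eq_top] at h1
  obtain ⟨k, -, h2⟩ := h1
  exact hk k h2

/-! ### Stationarity and the zero-one law -/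

section Field

variable {Θ : Type*} [MeasurableSpace Θ] {Q : Measure Θ} {φ : Θ → Plane → ℝ≥0}

lemma measurable_uncurry_shift (hφ : Measurable (Function.uncurry φ)) (x : Plane) :
    Measurable (Function.uncurry fun θ => shift x (φ θ)) :=
  hφ.comp (by fun_prop : Measurable fun p : Θ × Plane => (p.1, p.2 - x))

lemma measurableSet_mem_coveringSet (hφ : Measurable (Function.uncurry φ)) (t : ℝ) :
    MeasurableSet {p : Θ × Plane | p.2 ∈ coveringSet (φ p.1) t} :=
  measurableSet_le (by fun_prop) hφ.coe_nnreal_real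

/-- The finite dimensional distributions determine the law of a stationary field. -/
lemma IsStationary.map_shift [IsFiniteMeasure Q] (hφ : Measurable φ) (hstat : IsStationary φ Q)
    (x : Plane) : (Q.map φ).map (shift x) = Q.map φ := by
  have hshift : Measurable (shift x) :=
    measurable_pi_lambda _ fun y => measurable_pi_apply (y - x)
  rw [Measure.map_map hshift hφ]
  refine (map_eq_iff_forall_finset_map_restrict_eq (X := fun y θ => φ θ (y - x))
    (Y := fun y θ => φ θ y) (hshift.comp hφ).aemeasurable hφ.aemeasurable).2 fun I => ?_
  have h := (hstat (-x) I.card (fun i => (I.equivFin.symm i : Plane))).comp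
    (u := fun g (i : I) => g (I.equivFin i)) (by fun_prop)
  convert h.map_eq using 2
  · ext θ i
    simp [sub_eq_add_neg]
  · ext θ i
    simp

/-- By Fubini one sequence of points works for almost every θ. Treating two fields at once lets the
same sets serve a field and its shift. -/
lemma exists_measurableSet_ae_mem_iff [SFinite Q] {ψ : Θ → Plane → ℝ≥0}
    (hφ : Measurable (Function.uncurry φ)) (hψ : Measurable (Function.uncurry ψ)) :
    ∃ A : ℕ → Set (Plane → ℝ≥0), (∀ n, MeasurableSet (A n)) ∧
      (∀ᵐ θ ∂Q, ∀ n : ℕ, φ θ ∈ A n ↔ volume (coveringSet (φ θ) n) = ∞) ∧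
      ∀ᵐ θ ∂Q, ∀ n : ℕ, ψ θ ∈ A n ↔ volume (coveringSet (ψ θ) n) = ∞ := by
  obtain ⟨ν, hprob, hν⟩ := exists_seq_isProbabilityMeasure_tsum_eq_top_iff
  have key {χ : Θ → Plane → ℝ≥0} (hχ : Measurable (Function.uncurry χ)) :
      ∀ᵐ y ∂Measure.infinitePi ν, ∀ n : ℕ, ∀ᵐ θ ∂Q,
        (∃ᶠ k in atTop, y k ∈ coveringSet (χ θ) n) ↔ volume (coveringSet (χ θ) n) = ∞ := by
    refine ae_all_iff.2 fun n => ?_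
    simpa only [mem_ofPred_eq, ofPred_mem_eq] using
      ae_ae_frequently_mem_iff Q hν (measurableSet_mem_coveringSet hχ n)
  obtain ⟨y, hy1, hy2⟩ := ((key hφ).and (key hψ)).exists
  refine ⟨fun n => {f | ∃ᶠ k in atTop, y k ∈ coveringSet f n}, fun n => ?_,
    ae_all_iff.2 hy1, ae_all_iff.2 hy2⟩
  have (k : ℕ) : MeasurableSet {f : Plane → ℝ≥0 | y k ∈ coveringSet f n} :=
    measurableSet_le (by fun_prop) (measurable_pi_apply (y k)).coe_nnreal_real
  convert MeasurableSet.measurableSet_limsup this using 1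
  ext f
  rw [mem_limsup_iff_frequently_mem]
  rfl

variable [IsProbabilityMeasure Q]

lemma IsStationary.measure_volume_coveringSet_shift (hφ : Measurable (Function.uncurry φ))
    (hstat : IsStationary φ Q) (x : Plane) (n : ℕ) :
    Q {θ | volume (coveringSet (shift x (φ θ)) n) = ∞} =
      Q {θ | volume (coveringSet (φ θ) n) = ∞} := by
  have hφ' : Measurable φ := measurable_pi_lambda _ fun y => hφ.of_uncurry_right
  have hshift : Measurable (shift x) :=
    measurable_pi_lambda _ fun y => measurable_pi_apply (y - x)
  obtain ⟨A, hA, h1, h2⟩ := exists_measurableSet_ae_mem_iff (Q := Q) hφ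
    (measurable_uncurry_shift hφ x)
  have e1 : Q {θ | volume (coveringSet (φ θ) n) = ∞} = Q (φ ⁻¹' A n) := by
    refine measure_congr (eventuallyEq_set.2 ?_)
    filter_upwards [h1] with θ h using (h n).symm
  have e2 : Q {θ | volume (coveringSet (shift x (φ θ)) n) = ∞} = Q (φ ⁻¹' (shift x ⁻¹' A n)) := by
    refine measure_congr (eventuallyEq_set.2 ?_)
    filter_upwards [h2] with θ h using (h n).symm
  rw [e1, e2, ← Measure.map_apply hφ' (hA n), ← Measure.map_apply hφ' (hshift (hA n)),
    ← Measure.map_apply hshift (hA n), hstat.map_shift hφ' x]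

/-- The event that discs of arbitrary size are each covered from a set of infinite volume has
probability zero or one. -/
lemma IsErgodic.ae_forall_volume_coveringSet (hφ : Measurable (Function.uncurry φ))
    (hstat : IsStationary φ Q) (herg : IsErgodic φ Q)
    (hpos : Q {θ | ∀ n : ℕ, volume (coveringSet (φ θ) n) = ∞} ≠ 0) :
    ∀ᵐ θ ∂Q, ∀ n : ℕ, volume (coveringSet (φ θ) n) = ∞ := by
  have hφ' : Measurable φ := measurable_pi_lambda _ fun y => hφ.of_uncurry_right
  obtain ⟨A, hA, hφA, -⟩ := exists_measurableSet_ae_mem_iff (Q := Q) hφ hφ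
  have hAm : MeasurableSet (⋂ n, A n) := MeasurableSet.iInter hA
  have hmem : ∀ᵐ θ ∂Q, φ θ ∈ ⋂ n, A n ↔ ∀ n : ℕ, volume (coveringSet (φ θ) n) = ∞ := by
    filter_upwards [hφA] with θ h
    simp only [mem_iInter, h]
  have hinv (x : Plane) : shift x ⁻¹' (⋂ n, A n) =ᵐ[Q.map φ] ⋂ n, A n := by
    have hshift : Measurable (shift x) :=
      measurable_pi_lambda _ fun y => measurable_pi_apply (y - x)
    -- `B` may depend on `x`; it agrees with `A` up to null sets, and stationarity carries this
    -- through the shift.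
    obtain ⟨B, hB, h1, h2⟩ := exists_measurableSet_ae_mem_iff (Q := Q) hφ
      (measurable_uncurry_shift hφ x)
    have hBm : MeasurableSet (⋂ n, B n) := MeasurableSet.iInter hB
    have hAB : ((⋂ n, A n : Set _) : Set (Plane → ℝ≥0)) =ᵐ[Q.map φ] ⋂ n, B n := by
      refine eventuallyEq_set.2 ((ae_map_iff hφ'.aemeasurable (hAm.iff hBm)).2 ?_)
      filter_upwards [hmem, h1] with θ h h'
      change φ θ ∈ ⋂ n, A n ↔ φ θ ∈ ⋂ n, B n
      simp only [h, mem_iInter, h']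
    have hmp : MeasurePreserving (shift x) (Q.map φ) (Q.map φ) := ⟨hshift, hstat.map_shift hφ' x⟩
    refine (hmp.quasiMeasurePreserving.preimage_ae_eq hAB).trans ?_
    refine eventuallyEq_set.2 ((ae_map_iff hφ'.aemeasurable ((hshift hBm).iff hAm)).2 ?_)
    filter_upwards [hmem, h2] with θ h h'
    change shift x (φ θ) ∈ ⋂ n, B n ↔ φ θ ∈ ⋂ n, A n
    simp only [h, mem_iInter, h', forall_volume_coveringSet_shift_iff]
  have heq : Q.map φ (⋂ n, A n) = Q {θ | ∀ n : ℕ, volume (coveringSet (φ θ) n) = ∞} := by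
    rw [Measure.map_apply hφ' hAm]
    exact measure_congr (eventuallyEq_set.2 hmem)
  have hone : Q.map φ (⋂ n, A n) = 1 := (herg _ hAm hinv).resolve_left (heq ▸ hpos)
  rw [Measure.map_apply hφ' hAm] at hone
  have : ∀ᵐ θ ∂Q, φ θ ∈ ⋂ n, A n := (prob_compl_eq_zero_iff (hφ' hAm)).2 hone
  filter_upwards [hmem, this] with θ h h' using h.1 h'

/-- If the origin is covered from a set of infinite volume, then so is every disc about it. -/
lemma ae_forall_volume_coveringSet_eq_top (hφ : Measurable (Function.uncurry φ))
    (hstat : IsStationary φ Q) (herg : IsErgodic φ Q)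
    (h : ∀ᵐ θ ∂Q, volume (coveringSet (φ θ) 0) = ∞) :
    ∀ᵐ θ ∂Q, ∀ n : ℕ, volume (coveringSet (φ θ) n) = ∞ := by
  refine herg.ae_forall_volume_coveringSet hφ hstat ?_
  obtain ⟨k, hk⟩ : ∃ k, Q {θ | volume (cone (axisDirection k) ∩ coveringSet (φ θ) 0) = ∞} ≠ 0 := by
    by_contra! hk
    have h0 : ∀ᵐ θ ∂Q, ∀ k, ¬ volume (cone (axisDirection k) ∩ coveringSet (φ θ) 0) = ∞ :=
      ae_all_iff.2 fun k => measure_eq_zero_iff_ae_notMem.1 (hk k)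
    obtain ⟨θ, h1, h2⟩ := (h.and h0).exists
    obtain ⟨k, hk⟩ := exists_volume_cone_inter_eq_top h1
    exact h2 k hk
  have hmeas (n : ℕ) : MeasurableSet {θ | volume (coveringSet (φ θ) n) = ∞} := by
    exact measurable_measure_prodMk_left (measurableSet_mem_coveringSet hφ n)
      (measurableSet_singleton ∞)
  have hanti : Antitone fun n : ℕ => {θ | volume (coveringSet (φ θ) n) = ∞} := by
    intro m n hmn θ hθ
    refine measure_mono_top (fun y (hy : ‖y‖ + n ≤ φ θ y) => ?_) hθ
    have : (m : ℝ) ≤ n := by exact_mod_cast hmn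
    exact (by linarith : ‖y‖ + m ≤ φ θ y)
  -- Continuity from above: a lower bound uniform in n suffices.
  rw [ofPred_forall, hanti.measure_iInter (fun n => (hmeas n).nullMeasurableSet)
    ⟨0, measure_ne_top _ _⟩]
  refine ((pos_iff_ne_zero.2 hk).trans_le (le_iInf fun n => ?_)).ne'
  rw [← hstat.measure_volume_coveringSet_shift hφ (-((4 * n : ℝ) • axisDirection k)) n]
  exact measure_mono fun θ hθ =>
    volume_coveringSet_shift_of_cone (norm_axisDirection k) hθ n

end Field

/-! ### Atoms and measurability of configurations -/

namespace Config

variable (ν : Config)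

lemma count_ne_top {B : Set MarkedPlane} (hB : Bornology.IsBounded B) : ν.1 B ≠ ∞ := by
  obtain ⟨n, hn⟩ := ν.2 _ isClosed_closure.measurableSet hB.closure
  exact ne_top_of_le_ne_top (hn ▸ ENNReal.natCast_ne_top n) (measure_mono subset_closure)

/-- Every point of a configuration is an atom. -/
lemma measure_singleton_pos {p : MarkedPlane} (hp : p ∈ ν.points) : 0 < ν.1 {p} := by
  have hlim := tendsto_measure_biInter_gt (μ := ν.1) (s := fun r : ℝ => Metric.closedBall p r)
    (a := 0) (fun r _ => Metric.isClosed_closedBall.measurableSet.nullMeasurableSet)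
    (fun i j _ hij => Metric.closedBall_subset_closedBall hij)
    ⟨1, one_pos, ν.count_ne_top Metric.isBounded_closedBall⟩
  have hInter : ⋂ r > (0 : ℝ), Metric.closedBall p r = {p} := by
    ext q
    simp only [mem_iInter, Metric.mem_closedBall, mem_singleton_iff]
    exact ⟨fun h => dist_le_zero.1 (le_of_forall_gt_imp_ge_of_dense h), fun h r hr => by
      simpa [h] using hr.le⟩
  rw [hInter] at hlim
  -- Each closed ball about `p` has positive integer mass, hence at least 1.
  refine one_pos.trans_le (ge_of_tendsto hlim ?_)
  filter_upwards [self_mem_nhdsWithin] with r hr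
  obtain ⟨n, hn⟩ := ν.2 _ Metric.isClosed_closedBall.measurableSet
    (Metric.isBounded_closedBall (x := p) (r := r))
  have hpos : 0 < ν.1 (Metric.closedBall p r) :=
    (Measure.mem_support_iff_forall p).1 hp _ (Metric.closedBall_mem_nhds p hr)
  rw [Function.comp_apply, hn] at *
  exact_mod_cast hpos

lemma measure_pos_iff (S : Set MarkedPlane) : 0 < ν.1 S ↔ ∃ p ∈ ν.points, p ∈ S := by
  refine ⟨fun h => ?_, fun ⟨p, hp, hpS⟩ =>
    (ν.measure_singleton_pos hp).trans_le (measure_mono (singleton_subset_iff.2 hpS))⟩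
  obtain ⟨p, hpS, hp⟩ := Measure.nonempty_inter_support_of_pos h
  exact ⟨p, hp, hpS⟩

/-- Joint measurability of the number of points in a measurable family of sets. -/
lemma measurableSet_pos_prodMk_left {Θ : Type*} [MeasurableSpace Θ] {S : Set (Θ × MarkedPlane)}
    (hS : MeasurableSet S) :
    MeasurableSet {ω : Config × Θ | 0 < ω.1.1 (Prod.mk ω.2 ⁻¹' S)} := by
  obtain ⟨p₀⟩ : Nonempty MarkedPlane := inferInstance
  let B (n : ℕ) : Set MarkedPlane := Metric.ball p₀ n
  have hB (n : ℕ) : MeasurableSet (B n) := Metric.isOpen_ball.measurableSet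
  -- Normalising gives the uniform bound 1 of a finite kernel; as the mass of a ball is finite, its
  -- inverse is nonzero and positivity is preserved.
  let κ (n : ℕ) : Kernel (Config × Θ) MarkedPlane :=
    { toFun := fun ω => (ω.1.1 (B n))⁻¹ • ω.1.1.restrict (B n)
      measurable' := by
        refine Measure.measurable_of_measurable_coe _ fun s hs => ?_
        simp only [Measure.smul_apply, smul_eq_mul, Measure.restrict_apply hs]
        exact (((measurable_count (hB n)).comp measurable_fst).inv).mul
          ((measurable_count (hs.inter (hB n))).comp measurable_fst) }
  have hκ (n : ℕ) (ω : Config × Θ) : κ n ω = (ω.1.1 (B n))⁻¹ • ω.1.1.restrict (B n) := rfl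
  have hfin (n : ℕ) : IsFiniteKernel (κ n) := ⟨1, ENNReal.one_lt_top, fun ω => by
    rw [hκ, Measure.smul_apply, Measure.restrict_apply_univ, smul_eq_mul]
    exact ENNReal.inv_mul_le_one _⟩
  have hpos (ω : Config × Θ) : 0 < ω.1.1 (Prod.mk ω.2 ⁻¹' S) ↔
      ∃ n, 0 < κ n ω (Prod.mk ω.2 ⁻¹' S) := by
    have hS' : MeasurableSet (Prod.mk ω.2 ⁻¹' S) := measurable_prodMk_left hS
    have hU : Prod.mk ω.2 ⁻¹' S = ⋃ n, Prod.mk ω.2 ⁻¹' S ∩ B n := by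
      rw [← inter_iUnion, Metric.iUnion_ball_nat, inter_univ]
    simp only [hκ, Measure.smul_apply, smul_eq_mul, Measure.restrict_apply hS',
      pos_iff_ne_zero, mul_ne_zero_iff, ENNReal.inv_ne_zero,
      ω.1.count_ne_top (B := B _) Metric.isBounded_ball, ne_eq, not_false_eq_true, true_and]
    conv_lhs => rw [hU, measure_iUnion_null_iff]
    simp
  simp only [hpos, ofPred_exists]
  refine MeasurableSet.iUnion fun n => ?_
  have ht : MeasurableSet {q : (Config × Θ) × MarkedPlane | (q.1.2, q.2) ∈ S} :=
    (by fun_prop : Measurable fun q : (Config × Θ) × MarkedPlane => (q.1.2, q.2)) hS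
  exact measurableSet_lt measurable_const (Kernel.measurable_kernel_prodMk_left (κ := κ n) ht)

end Config

/-! ### Poisson void probabilities and coverage -/

variable {l : ℝ≥0} {P : Measure Config}

lemma IsPoissonLaw.measure_count_eq_zero (hP : IsPoissonLaw l P) {B : Set MarkedPlane}
    (hB : MeasurableSet B) (hv : volume B ≠ ∞) :
    P {ν | ν.1 B = 0} = ENNReal.ofReal (Real.exp (-(l * (volume B).toNNReal : ℝ≥0))) := by
  have h := DFunLike.congr_fun (hP.map_count B hB hv) {0}
  rw [Measure.map_apply (Config.measurable_count hB) (measurableSet_singleton _),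
    Measure.map_apply (by fun_prop) (measurableSet_singleton _)] at h
  have h1 : (fun n : ℕ => (n : ℝ≥0∞)) ⁻¹' {0} = {0} := by ext; simp
  rw [h1] at h
  refine h.trans ?_
  simp [poissonMeasure_singleton]

/-- Bounded parts of `B` have arbitrarily large finite volume, so the void probability is below
every exp(-lM). -/
lemma IsPoissonLaw.ae_measure_pos (hP : IsPoissonLaw l P) (hl : 0 < l) {B : Set MarkedPlane}
    (hB : MeasurableSet B) (hv : volume B = ∞) : ∀ᵐ ν ∂P, 0 < ν.1 B := by
  obtain ⟨p₀⟩ : Nonempty MarkedPlane := inferInstance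
  have hmono : Monotone fun n : ℕ => B ∩ Metric.ball p₀ n := fun m n hmn =>
    inter_subset_inter_right _ (Metric.ball_subset_ball (by exact_mod_cast hmn))
  have hU : ⋃ n : ℕ, B ∩ Metric.ball p₀ n = B := by
    rw [← inter_iUnion, Metric.iUnion_ball_nat, inter_univ]
  have hsup : ⨆ n : ℕ, volume (B ∩ Metric.ball p₀ n) = ∞ := by
    rw [← hmono.measure_iUnion, hU, hv]
  have hle (M : ℕ) : P {ν | ν.1 B = 0} ≤ ENNReal.ofReal (Real.exp (-(l * M : ℝ))) := by
    obtain ⟨n, hn⟩ := lt_iSup_iff.1 (hsup ▸ ENNReal.natCast_lt_top M)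
    have hfin : volume (B ∩ Metric.ball p₀ n) ≠ ∞ :=
      ne_top_of_le_ne_top measure_ball_lt_top.ne (measure_mono inter_subset_right)
    calc P {ν | ν.1 B = 0} ≤ P {ν | ν.1 (B ∩ Metric.ball p₀ n) = 0} :=
          measure_mono fun ν hν => measure_mono_null inter_subset_left hν
      _ = _ := hP.measure_count_eq_zero (hB.inter Metric.isOpen_ball.measurableSet) hfin
      _ ≤ _ := by
        have hM : (M : ℝ≥0) ≤ (volume (B ∩ Metric.ball p₀ n)).toNNReal := by
          rw [← ENNReal.toNNReal_natCast]
          exact ENNReal.toNNReal_mono hfin hn.le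
        gcongr
        push_cast
        gcongr
        exact_mod_cast hM
  have hlim : Tendsto (fun M : ℕ => ENNReal.ofReal (Real.exp (-(l * M : ℝ)))) atTop (𝓝 0) := by
    rw [← ENNReal.ofReal_zero]
    refine ENNReal.tendsto_ofReal (Real.tendsto_exp_neg_atTop_nhds_zero.comp ?_)
    exact tendsto_natCast_atTop_atTop.const_mul_atTop (by exact_mod_cast hl)
  have h0 : P {ν | ν.1 B = 0} = 0 := le_antisymm (ge_of_tendsto' hlim hle) zero_le
  filter_upwards [measure_eq_zero_iff_ae_notMem.1 h0] with ν hν using pos_iff_ne_zero.2 hν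

lemma volume_prod_univ_unitInterval (T : Set Plane) :
    volume (T ×ˢ (univ : Set unitInterval)) = volume T := by
  rw [Measure.volume_eq_prod, Measure.prod_prod, measure_univ, mul_one]

lemma zero_mem_occupied_iff (η : Config) (f : Plane → ℝ≥0) :
    (0 : Plane) ∈ occupied η f ↔ 0 < η.1 (coveringSet f 0 ×ˢ univ) := by
  simp [Config.measure_pos_iff, occupied, coveringSet]

lemma occupied_eq_univ {η : Config} {f : Plane → ℝ≥0}
    (h : ∀ n : ℕ, 0 < η.1 (coveringSet f n ×ˢ univ)) : occupied η f = univ := by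
  refine eq_univ_of_forall fun x => ?_
  obtain ⟨n, hn⟩ := exists_nat_ge ‖x‖
  obtain ⟨p, hp, hpn, -⟩ := (η.measure_pos_iff _).1 (h n)
  refine mem_iUnion₂.2 ⟨p, hp, ?_⟩
  have h1 : ‖p.1‖ + n ≤ f p.1 := hpn
  rw [Metric.mem_closedBall, dist_eq_norm]
  linarith [norm_sub_le x p.1]

variable {Θ : Type*} [MeasurableSpace Θ] {Q : Measure Θ} [IsProbabilityMeasure Q]
  {φ : Θ → Plane → ℝ≥0} {l : ℝ≥0} {P : Measure Config}

lemma IsPoissonLaw.ae_volume_coveringSet_eq_top (hP : IsPoissonLaw l P)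
    (hφ : Measurable (Function.uncurry φ))
    (h : ∀ᵐ ω ∂(P.prod Q), (0 : Plane) ∈ occupied ω.1 (φ ω.2)) :
    ∀ᵐ θ ∂Q, volume (coveringSet (φ θ) 0) = ∞ := by
  have := hP.isProbabilityMeasure
  have hswap : ∀ᵐ ω ∂(Q.prod P), (0 : Plane) ∈ occupied ω.2 (φ ω.1) :=
    Measure.measurePreserving_swap.quasiMeasurePreserving.ae h
  filter_upwards [Measure.ae_ae_of_ae_prod hswap] with θ hθ
  by_contra hne
  have hm : MeasurableSet (coveringSet (φ θ) 0) := measurableSet_coveringSet hφ.of_uncurry_left 0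
  have h0 := hP.measure_count_eq_zero (hm.prod MeasurableSet.univ)
    (by rwa [volume_prod_univ_unitInterval])
  have h1 : P {ν | ν.1 (coveringSet (φ θ) 0 ×ˢ univ) = 0} = 0 := by
    refine measure_eq_zero_iff_ae_notMem.2 ?_
    filter_upwards [hθ] with ν hν using ((zero_mem_occupied_iff ν (φ θ)).1 hν).ne'
  rw [h1] at h0
  exact (ENNReal.ofReal_pos.2 (Real.exp_pos _)).ne h0

lemma IsPoissonLaw.ae_occupied_eq_univ (hP : IsPoissonLaw l P) (hl : 0 < l)
    (hφ : Measurable (Function.uncurry φ))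
    (h : ∀ᵐ θ ∂Q, ∀ n : ℕ, volume (coveringSet (φ θ) n) = ∞) :
    ∀ᵐ ω ∂(P.prod Q), occupied ω.1 (φ ω.2) = univ := by
  have := hP.isProbabilityMeasure
  have hpos : ∀ᵐ ω ∂(P.prod Q), ∀ n : ℕ, 0 < ω.1.1 (coveringSet (φ ω.2) n ×ˢ univ) := by
    refine ae_all_iff.2 fun n => ?_
    have hS : MeasurableSet {q : Θ × MarkedPlane | q.2.1 ∈ coveringSet (φ q.1) n} :=
      (by fun_prop : Measurable fun q : Θ × MarkedPlane => (q.1, q.2.1))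
        (measurableSet_mem_coveringSet hφ n)
    have hsec (θ : Θ) : Prod.mk θ ⁻¹' {q : Θ × MarkedPlane | q.2.1 ∈ coveringSet (φ q.1) n} =
        coveringSet (φ θ) n ×ˢ univ := by
      ext; simp
    have hmeas := Config.measurableSet_pos_prodMk_left hS
    simp only [hsec] at hmeas
    have hcomm : ∀ᵐ θ ∂Q, ∀ᵐ ν ∂P, 0 < ν.1 (coveringSet (φ θ) n ×ˢ univ) := by
      filter_upwards [h] with θ hθ
      exact hP.ae_measure_pos hl
        ((measurableSet_coveringSet hφ.of_uncurry_left n).prod MeasurableSet.univ)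
        (by rw [volume_prod_univ_unitInterval, hθ n])
    -- Joint measurability permits conditioning on the field first.
    exact (Measure.ae_prod_iff_ae_ae hmeas).2 ((Measure.ae_ae_comm hmeas).2 hcomm)
  filter_upwards [hpos] with ω hω using occupied_eq_univ hω

end Gilbert

open Gilbert in
theorem proposition2p2 {Θ : Type*} [MeasurableSpace Θ]
    (Q : Measure Θ) [IsProbabilityMeasure Q]
    (φ : Θ → Plane → ℝ≥0) (hφ : Measurable (Function.uncurry φ))
    (hstat : IsStationary φ Q) (herg : IsErgodic φ Q)
    (P : ℝ≥0 → Measure Config) (hP : ∀ l : ℝ≥0, 0 < l → IsPoissonLaw l (P l)) :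
    List.TFAE [
      ∃ l : ℝ≥0, 0 < l ∧ ∀ᵐ ω ∂((P l).prod Q), (0 : Plane) ∈ occupied ω.1 (φ ω.2),
      ∀ l : ℝ≥0, 0 < l → ∀ᵐ ω ∂((P l).prod Q), (0 : Plane) ∈ occupied ω.1 (φ ω.2),
      ∀ l : ℝ≥0, 0 < l → ∀ᵐ ω ∂((P l).prod Q), occupied ω.1 (φ ω.2) = Set.univ] := by
  tfae_have 1 → 3 := by
    rintro ⟨l₀, hl₀, h⟩ l hl
    have h0 := (hP l₀ hl₀).ae_volume_coveringSet_eq_top hφ h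
    exact (hP l hl).ae_occupied_eq_univ hl hφ
      (ae_forall_volume_coveringSet_eq_top hφ hstat herg h0)
  tfae_have 3 → 2 := by
    intro h l hl
    filter_upwards [h l hl] with ω hω
    rw [hω]
    exact mem_univ 0
  tfae_have 2 → 1 := fun h => ⟨1, one_pos, h 1 one_pos⟩
  tfae_finish
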